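/- Let $P(z_1,z_2)=\sum_{k=-n_1}^{n_1}p_k(z_2)z_1^k$ be a bivariate Laurent polynomial with complex coefficients, where each $p_k(z_2)=\sum_{l=-n_2}^{n_2}p_{kl}z_2^l$ is a Laurent polynomial in $z_2$ and $n_1,n_2\ge 0$ are integers. Suppose that there is an $\epsilon>0$ such that $P(z_1,z_2)$ is real and $P(z_1,z_2)\ge\epsilon$ for all $|z_1|=|z_2|=1$. Put $C_1=\sup_{|k|\le n_1,\ |z_2|=1}|p_k(z_2)|$. Then, for every integer $m_1>n_1$ with $$\frac{n_1(n_1+1)\,C_1}{2(m_1-n_1)}<\epsilon,$$ there are $N\le m_1+1$ polynomials $Q_1,\dots,Q_N\in\mathbb{C}[z_1,z_2]$, each of degree at most $m_1$ in $z_1$ and at most $n_2$ in $z_2$, such that $$P(z_1,z_2)=\sum_{k=1}^{N}|Q_k(z_1,z_2)|^2\qquad\text{for all } |z_1|=|z_2|=1.$$ -/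

import Mathlib

open scoped LaurentPolynomial

/-- The value `p(z) = ∑ₗ cₗ zˡ` of a univariate complex Laurent polynomial at a point `z` of the
unit circle. -/
noncomputable def torusEval₁ (p : ℂ[T;T⁻¹]) (z : Circle) : ℂ :=
  p.coeff.sum fun l c => c * (z : ℂ) ^ l

/-- The value `P(z₁, z₂) = ∑ₖ pₖ(z₂) z₁ᵏ` at a point of the bi-torus. A bivariate complex Laurent
polynomial is represented as a Laurent polynomial in `z₁` whose coefficients `pₖ = P.coeff k` are
complex Laurent polynomials in `z₂`. -/
noncomputable def torusEval₂ (P : ℂ[T;T⁻¹][T;T⁻¹]) (z₁ z₂ : Circle) : ℂ :=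
  P.coeff.sum fun k p => torusEval₁ p z₂ * (z₁ : ℂ) ^ k

/-- `P(z₁, z₂) = ∑_{|k| ≤ n₁} pₖ(z₂) z₁ᵏ` with every `pₖ(z₂) = ∑_{|l| ≤ n₂} pₖₗ z₂ˡ`. -/
def HasCoordDegreeLE (P : ℂ[T;T⁻¹][T;T⁻¹]) (n₁ n₂ : ℕ) : Prop :=
  (∀ k : ℤ, (n₁ : ℤ) < |k| → P.coeff k = 0) ∧
    ∀ k l : ℤ, (n₂ : ℤ) < |l| → (P.coeff k).coeff l = 0

/-- The constant `sup_{k, |z₂| = 1} |pₖ(z₂)|`. The index `k` runs over all integers; only finitely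
many `pₖ` are nonzero, so this is the supremum over the `k` that occur in `P`. -/
noncomputable def coeffSup (P : ℂ[T;T⁻¹][T;T⁻¹]) : ℝ :=
  ⨆ x : ℤ × Circle, ‖torusEval₁ (P.coeff x.1) x.2‖

theorem norm_torusEval₁_le (p : ℂ[T;T⁻¹]) (z : Circle) :
    ‖torusEval₁ p z‖ ≤ ∑ l ∈ p.coeff.support, ‖p.coeff l‖ := by
  unfold torusEval₁ Finsupp.sum
  refine (norm_sum_le _ _).trans (le_of_eq (Finset.sum_congr rfl fun l _ => ?_))
  rw [norm_mul, norm_zpow, Circle.norm_coe, one_zpow, mul_one]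

/-- The supremum in `coeffSup` is a genuine one. -/
theorem isLUB_coeffSup (P : ℂ[T;T⁻¹][T;T⁻¹]) :
    IsLUB (Set.range fun x : ℤ × Circle => ‖torusEval₁ (P.coeff x.1) x.2‖) (coeffSup P) := by
  refine isLUB_ciSup ⟨∑ k ∈ P.coeff.support,
    ∑ l ∈ (P.coeff k).coeff.support, ‖(P.coeff k).coeff l‖, ?_⟩
  rintro _ ⟨⟨k, z⟩, rfl⟩
  have h0 : ∀ j ∈ P.coeff.support,
      0 ≤ ∑ l ∈ (P.coeff j).coeff.support, ‖(P.coeff j).coeff l‖ :=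
    fun j _ => Finset.sum_nonneg fun l _ => norm_nonneg _
  by_cases hk : k ∈ P.coeff.support
  · exact (norm_torusEval₁_le _ z).trans (Finset.single_le_sum h0 hk)
  · have : P.coeff k = 0 := by simpa using hk
    simpa [this, torusEval₁] using Finset.sum_nonneg h0

/-! Put `v(z₁) = (z₁^m₁, …, z₁, 1)` and let `G(z₂)` be the Toeplitz matrix with entries `p_{i-j}(z₂)
/ (m₁ + 1 - |i - j|)`. The `k`-th diagonal has `m₁ + 1 - |k|` entries, so `v* G v = P`. If `G(z₂)`
is uniformly positive definite on the circle, the matrix Fejér–Riesz theorem in `z₂` gives `G = A*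
A` with `A` a matrix polynomial of degree at most `n₂`, and the `m₁ + 1` entries of `A(z₂) v(z₁)`
are the required polynomials.

Positivity of `G` follows from positivity of its symbol. Multiplied by `m₁ + 1`, the symbol is `P`
plus the correction `∑ |k| / (m₁ + 1 - |k|) pₖ z₁ᵏ`. For fixed `z₂`, a scalar Fejér–Riesz
factorization `pₖ = ∑_{j-i=k} q̄ᵢ qⱼ` bounds the correction below by `-n₁(n₁+1) p₀ / (2(m₁-n₁))`,
since `∑ |qᵢ|² = p₀`. This is where the hypothesis on `m₁` enters
(`le_re_trigSum_cesaro_correction`, `le_re_cesaro_toeplitz`).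

For the matrix Fejér–Riesz theorem (`exists_fejerRiesz_factorization`), let `F` be the first block
column of the inverse of the half-infinite Toeplitz matrix of `Q`, a limit of finite sections. Then
`R = Q * F` lives on `[-n, 0]` with `R₀ = 1`. Computing `∑ Fₗ* R_{l+k}` in two ways, using `Q* = Q`,
shows that `F₀⁻¹ R*` inverts `F`. Hence `Q = R F₀⁻¹ R*`, and splitting `F₀⁻¹ = B* B` gives the
factor `B R*`. -/

/-! ### Fourier coefficients on the circle by averaging over roots of unity. -/

/-- The linear combination `∑_{|k| ≤ n} zᵏ Qₖ` at a point `z` of the unit circle. -/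
noncomputable def trigSum {E : Type*} [AddCommGroup E] [Module ℂ E] (n : ℕ) (Q : ℤ → E)
    (z : Circle) : E :=
  ∑ k ∈ Finset.Icc (-(n : ℤ)) n, (z : ℂ) ^ k • Q k

/-- The mean of a function over the `K`-th roots of unity. -/
noncomputable def rootsMean (K : ℕ) : (Circle → ℂ) →ₗ[ℂ] ℂ where
  toFun f := (K : ℂ)⁻¹ * ∑ j ∈ Finset.range K, f (Circle.exp (2 * Real.pi / K) ^ j)
  map_add' f g := by simp [Finset.sum_add_distrib, mul_add]
  map_smul' c f := by simp [← Finset.mul_sum, mul_left_comm]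

/-- A nonzero `k` with `|k| < K` is not a multiple of `K`, so the geometric sum vanishes. For
trigonometric polynomials of low degree the finite mean thus replaces integration over the circle.
-/
theorem rootsMean_zpow {K : ℕ} {k : ℤ} (hk : |k| < K) :
    rootsMean K (fun z => (z : ℂ) ^ k) = if k = 0 then 1 else 0 := by
  have hK : (K : ℂ) ≠ 0 := by
    have : 0 < (K : ℤ) := (abs_nonneg k).trans_lt hk
    exact_mod_cast this.ne'
  have hK' : K ≠ 0 := by exact_mod_cast hK
  have hprim : IsPrimitiveRoot ((Circle.exp (2 * Real.pi / K) : Circle) : ℂ) K := by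
    convert Complex.isPrimitiveRoot_exp K hK' using 1
    rw [Circle.coe_exp]
    push_cast
    congr 1
    ring
  set ζ : Circle := Circle.exp (2 * Real.pi / K)
  split_ifs with h
  · subst h
    simp [rootsMean, hK]
  · have hne : (ζ : ℂ) ^ k ≠ 1 := by
      rw [Ne, hprim.zpow_eq_one_iff_dvd]
      intro hd
      exact h (Int.eq_zero_of_abs_lt_dvd hd hk)
    have hpow : ((ζ : ℂ) ^ k) ^ K = 1 := by
      rw [← zpow_natCast, zpow_comm, zpow_natCast, hprim.pow_eq_one, one_zpow]
    have hsum : ∑ j ∈ Finset.range K, ((ζ : ℂ) ^ k) ^ j = 0 := by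
      rw [geom_sum_eq hne, hpow, sub_self, zero_div]
    change (K : ℂ)⁻¹ * ∑ j ∈ Finset.range K, ((ζ ^ j : Circle) : ℂ) ^ k = 0
    have : ∀ j, ((ζ ^ j : Circle) : ℂ) ^ k = ((ζ : ℂ) ^ k) ^ j := by
      intro j
      rw [Circle.coe_pow, ← zpow_natCast, ← zpow_natCast, zpow_comm]
    simp only [this, hsum, mul_zero]

theorem rootsMean_re_nonneg {K : ℕ} {f : Circle → ℂ} (hf : ∀ z, 0 ≤ (f z).re) :
    0 ≤ (rootsMean K f).re := by
  change 0 ≤ ((K : ℂ)⁻¹ * ∑ j ∈ Finset.range K, f (Circle.exp (2 * Real.pi / K) ^ j)).re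
  rw [show ((K : ℂ)⁻¹) = (((K : ℝ)⁻¹ : ℝ) : ℂ) by push_cast; rfl, Complex.re_ofReal_mul,
    Complex.re_sum]
  exact mul_nonneg (by positivity) (Finset.sum_nonneg fun j _ => hf _)

theorem Circle.star_zpow (z : Circle) (k : ℤ) : star ((z : ℂ) ^ k) = (z : ℂ) ^ (-k) := by
  rw [star_zpow₀, zpow_neg, ← inv_zpow]
  congr 1
  exact (Circle.coe_inv_eq_conj z).symm

/-- A Laurent polynomial is determined by its values on the unit circle. -/
theorem coeff_eq_of_trigSum_eq {n : ℕ} {a b : ℤ → ℂ} (ha : ∀ k, (n : ℤ) < |k| → a k = 0)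
    (hb : ∀ k, (n : ℤ) < |k| → b k = 0) (h : ∀ z, trigSum n a z = trigSum n b z) : a = b := by
  have key : ∀ (c : ℤ → ℂ) (k : ℤ), |k| ≤ n →
      rootsMean (2 * n + 1) (fun z => (z : ℂ) ^ (-k) * trigSum n c z) = c k := by
    intro c k hk
    have : (fun z : Circle => (z : ℂ) ^ (-k) * trigSum n c z) =
        ∑ j ∈ Finset.Icc (-(n : ℤ)) n, c j • fun z : Circle => (z : ℂ) ^ (j - k) := by
      ext z
      simp only [trigSum, Finset.mul_sum, Finset.sum_apply, Pi.smul_apply, smul_eq_mul]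
      refine Finset.sum_congr rfl fun j _ => ?_
      rw [sub_eq_neg_add, zpow_add₀ (Circle.coe_ne_zero z)]
      ring
    rw [this, map_sum, Finset.sum_eq_single k]
    · rw [map_smul, rootsMean_zpow (by simp)]
      simp
    · intro j hj hjk
      rw [map_smul, rootsMean_zpow, if_neg (sub_ne_zero.2 hjk), smul_zero]
      rw [Finset.mem_Icc] at hj
      rw [abs_le] at hk
      rw [abs_lt]
      push_cast
      constructor <;> linarith
    · intro hk'
      rw [abs_le] at hk
      exact absurd (Finset.mem_Icc.2 hk) hk'
  ext k
  by_cases hk : |k| ≤ n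
  · rw [← key a k hk, ← key b k hk]
    simp only [h]
  · rw [ha k (not_le.1 hk), hb k (not_le.1 hk)]

theorem star_trigSum {n : ℕ} (a : ℤ → ℂ) (z : Circle) :
    star (trigSum n a z) = trigSum n (fun k => star (a (-k))) z := by
  unfold trigSum
  rw [star_sum]
  refine Finset.sum_nbij' (fun k => -k) (fun k => -k) ?_ ?_ ?_ ?_ ?_
  · intro k hk; rw [Finset.mem_Icc] at *; constructor <;> linarith
  · intro k hk; rw [Finset.mem_Icc] at *; constructor <;> linarith
  · simp
  · simp
  · intro k _
    simp only [smul_eq_mul, star_mul', Circle.star_zpow, neg_neg]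

/-! ### Block Toeplitz quadratic forms and their symbols. -/

section Toeplitz

open Matrix

variable {ι : Type*} [Fintype ι]

/-- The quadratic form of the `N × N` block Toeplitz matrix with symbol `∑ zᵏ Qₖ`. -/
noncomputable def toeplitzForm (Q : ℤ → Matrix ι ι ℂ) (N : ℕ) (x : ℕ → ι → ℂ) : ℂ :=
  ∑ i ∈ Finset.range N, ∑ j ∈ Finset.range N, star (x i) ⬝ᵥ (Q (i - j) *ᵥ x j)

/-- After expansion only the frequencies `k + j - i` occur, of modulus less than `N + n + 1`, so the
mean retains exactly the terms with `k = i - j`. -/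
theorem toeplitzForm_eq_rootsMean {n : ℕ} {Q : ℤ → Matrix ι ι ℂ}
    (hQ : ∀ k, (n : ℤ) < |k| → Q k = 0) (N : ℕ) (x : ℕ → ι → ℂ) :
    toeplitzForm Q N x = rootsMean (N + n + 1) (fun z =>
      star (∑ j ∈ Finset.range N, (z : ℂ) ^ (j : ℤ) • x j) ⬝ᵥ
        (trigSum n Q z *ᵥ ∑ j ∈ Finset.range N, (z : ℂ) ^ (j : ℤ) • x j)) := by
  have : (fun z : Circle => star (∑ j ∈ Finset.range N, (z : ℂ) ^ (j : ℤ) • x j) ⬝ᵥ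
        (trigSum n Q z *ᵥ ∑ j ∈ Finset.range N, (z : ℂ) ^ (j : ℤ) • x j)) =
      ∑ i ∈ Finset.range N, ∑ j ∈ Finset.range N, ∑ k ∈ Finset.Icc (-(n : ℤ)) n,
        (star (x i) ⬝ᵥ (Q k *ᵥ x j)) • fun z : Circle => (z : ℂ) ^ (k + j - i) := by
    ext z
    simp only [trigSum, star_sum, sum_dotProduct, mulVec_sum, dotProduct_sum, sum_mulVec,
      Finset.sum_apply, Pi.smul_apply, star_smul, smul_dotProduct, smul_mulVec, mulVec_smul,
      dotProduct_smul, Circle.star_zpow, smul_eq_mul]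
    conv_rhs => rw [Finset.sum_comm]
    refine Finset.sum_congr rfl fun j _ => ?_
    rw [Finset.sum_comm, Finset.mul_sum]
    refine Finset.sum_congr rfl fun k _ => ?_
    rw [Finset.mul_sum, Finset.mul_sum]
    refine Finset.sum_congr rfl fun i _ => ?_
    rw [sub_eq_add_neg, zpow_add₀ (Circle.coe_ne_zero z), zpow_add₀ (Circle.coe_ne_zero z)]
    ring
  rw [this, map_sum]
  refine Finset.sum_congr rfl fun i hi => ?_
  rw [map_sum]
  refine Finset.sum_congr rfl fun j hj => ?_
  rw [map_sum]
  rw [Finset.mem_range] at hi hj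
  have hmean : ∀ k ∈ Finset.Icc (-(n : ℤ)) n, rootsMean (N + n + 1)
      ((star (x i) ⬝ᵥ (Q k *ᵥ x j)) • fun z : Circle => (z : ℂ) ^ (k + j - i)) =
      if k = i - j then star (x i) ⬝ᵥ (Q k *ᵥ x j) else 0 := by
    intro k hk
    rw [Finset.mem_Icc] at hk
    rw [map_smul, rootsMean_zpow (by rw [abs_lt]; push_cast; constructor <;> linarith)]
    by_cases h : k = i - j
    · rw [if_pos h, if_pos (by linarith), smul_eq_mul, mul_one]
    · rw [if_neg h, if_neg (fun h' => h (by linarith)), smul_zero]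
  rw [Finset.sum_congr rfl hmean, Finset.sum_ite_eq']
  split_ifs with h
  · rfl
  · rw [hQ, zero_mulVec, dotProduct_zero]
    rw [Finset.mem_Icc, ← abs_le] at h
    exact not_le.1 h

theorem star_dotProduct_self_re (v : ι → ℂ) : (star v ⬝ᵥ v).re = ∑ a, ‖v a‖ ^ 2 := by
  simp [dotProduct, Complex.re_sum, Complex.conj_mul', ← Complex.ofReal_pow]

/-- A lower bound of the symbol is a lower bound of the block Toeplitz matrix. -/
theorem le_toeplitzForm_re [DecidableEq ι] {n : ℕ} {Q : ℤ → Matrix ι ι ℂ}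
    (hQ : ∀ k, (n : ℤ) < |k| → Q k = 0) {δ : ℝ}
    (hpos : ∀ (z : Circle) (v : ι → ℂ),
      δ * ∑ a, ‖v a‖ ^ 2 ≤ (star v ⬝ᵥ (trigSum n Q z *ᵥ v)).re) (N : ℕ) (x : ℕ → ι → ℂ) :
    δ * ∑ i ∈ Finset.range N, ∑ a, ‖x i a‖ ^ 2 ≤ (toeplitzForm Q N x).re := by
  -- The constant symbol `δ • 1` has form `δ ∑ ‖xᵢ‖²`. The claim becomes nonnegativity of the mean
  -- of a pointwise nonnegative difference.
  set E : ℤ → Matrix ι ι ℂ := fun k => if k = 0 then (δ : ℂ) • 1 else 0 with hE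
  have hE0 : ∀ k, (n : ℤ) < |k| → E k = 0 := by
    intro k hk
    refine if_neg ?_
    rintro rfl
    simp at hk
    omega
  have hEz : ∀ z, trigSum n E z = (δ : ℂ) • 1 := by
    intro z
    simp [trigSum, hE]
  have hform : toeplitzForm E N x = δ * ∑ i ∈ Finset.range N, star (x i) ⬝ᵥ x i := by
    rw [toeplitzForm, Finset.mul_sum]
    refine Finset.sum_congr rfl fun i hi => ?_
    rw [Finset.sum_eq_single i]
    · simp [hE, smul_mulVec]
    · intro j _ hj
      have : ((i : ℤ) - j) ≠ 0 := by omega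
      simp [hE, this]
    · exact fun h => absurd hi h
  have hre : (toeplitzForm E N x).re = δ * ∑ i ∈ Finset.range N, ∑ a, ‖x i a‖ ^ 2 := by
    rw [hform, Complex.re_ofReal_mul, Complex.re_sum]
    simp only [star_dotProduct_self_re]
  rw [← hre, ← sub_nonneg, ← Complex.sub_re, toeplitzForm_eq_rootsMean hQ,
    toeplitzForm_eq_rootsMean hE0, ← map_sub]
  refine rootsMean_re_nonneg fun z => ?_
  simp only [Pi.sub_apply, hEz, Complex.sub_re, sub_nonneg]
  refine le_trans (le_of_eq ?_) (hpos z _)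
  rw [smul_mulVec, one_mulVec, dotProduct_smul, smul_eq_mul, Complex.re_ofReal_mul,
    star_dotProduct_self_re]

end Toeplitz

/-! ### Inverting the half-infinite Toeplitz matrix on its first block column. -/

section FejerRiesz

open Matrix Filter Topology

variable {ι : Type*} [Fintype ι]

/-- Coercivity of the form makes the finite section injective, hence surjective in finite dimension;
the block column is then solved for one scalar column at a time. -/
theorem exists_toeplitz_inverse_column [DecidableEq ι] {Q : ℤ → Matrix ι ι ℂ} {δ : ℝ} (hδ : 0 < δ)
    (hform : ∀ N x, δ * ∑ i ∈ Finset.range N, ∑ a, ‖x i a‖ ^ 2 ≤ (toeplitzForm Q N x).re) (N : ℕ) :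
    ∃ X : ℕ → Matrix ι ι ℂ, (∀ i < N, ∑ j ∈ Finset.range N, Q (i - j) * X j =
      if i = 0 then 1 else 0) := by
  let T : (Fin N → ι → ℂ) →ₗ[ℂ] (Fin N → ι → ℂ) :=
    { toFun := fun x i => ∑ j : Fin N, Q ((i : ℕ) - (j : ℕ)) *ᵥ x j
      map_add' := fun x y => by
        ext i : 1
        simp [mulVec_add, Finset.sum_add_distrib]
      map_smul' := fun c x => by
        ext i : 1
        simp [mulVec_smul, Finset.smul_sum] }
  have hinj : Function.Injective T := by
    rw [injective_iff_map_eq_zero]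
    intro x hx
    let y : ℕ → ι → ℂ := fun i => if h : i < N then x ⟨i, h⟩ else 0
    have hy : ∀ i : Fin N, y i = x i := fun i => by simp [y]
    have h0 : toeplitzForm Q N y = 0 := by
      unfold toeplitzForm
      rw [Finset.sum_range]
      refine Finset.sum_eq_zero fun i _ => ?_
      rw [← dotProduct_sum, Finset.sum_range]
      simp only [hy]
      have : ∑ j : Fin N, Q ((i : ℕ) - (j : ℕ)) *ᵥ x j = 0 := congrFun hx i
      rw [this, dotProduct_zero]
    have h1 := hform N y
    rw [h0, Complex.zero_re, Finset.sum_range] at h1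
    have h2 : ∑ i : Fin N, ∑ a, ‖y i a‖ ^ 2 = 0 := by
      refine le_antisymm ?_ (by positivity)
      by_contra! h
      exact absurd h1 (not_le.2 (mul_pos hδ h))
    rw [Finset.sum_eq_zero_iff_of_nonneg (fun _ _ => by positivity)] at h2
    ext i a
    have h3 := h2 i (Finset.mem_univ _)
    rw [Finset.sum_eq_zero_iff_of_nonneg (fun _ _ => by positivity)] at h3
    have h4 := h3 a (Finset.mem_univ _)
    rw [hy] at h4
    simpa using h4
  have hsurj : Function.Surjective T := LinearMap.injective_iff_surjective.1 hinj
  choose x hx using fun b : ι => hsurj fun i a => if (i : ℕ) = 0 then (1 : Matrix ι ι ℂ) a b else 0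
  refine ⟨fun j => of fun a b => if h : j < N then x b ⟨j, h⟩ a else 0, fun i hi => ?_⟩
  ext a b
  have h1 := congrFun (congrFun (hx b) ⟨i, hi⟩) a
  have h2 : T (x b) ⟨i, hi⟩ a = ∑ j : Fin N, ∑ c, Q (i - (j : ℕ)) a c * x b j c := by
    simp [T, Finset.sum_apply, mulVec, dotProduct]
  rw [h2] at h1
  rw [Matrix.sum_apply, Finset.sum_range]
  simp only [mul_apply, of_apply, Fin.is_lt, dif_pos]
  refine h1.trans ?_
  split_ifs <;> simp

theorem toeplitzForm_eq_of_inverse_column [DecidableEq ι] {Q : ℤ → Matrix ι ι ℂ} {N : ℕ}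
    (hN : 0 < N) {X : ℕ → Matrix ι ι ℂ}
    (hX : ∀ i < N, ∑ j ∈ Finset.range N, Q (i - j) * X j = if i = 0 then 1 else 0) (v : ι → ℂ) :
    toeplitzForm Q N (fun i => X i *ᵥ v) = star (X 0 *ᵥ v) ⬝ᵥ v := by
  have h : ∀ i ∈ Finset.range N, ∑ j ∈ Finset.range N,
      star (X i *ᵥ v) ⬝ᵥ (Q (i - j) *ᵥ X j *ᵥ v) =
      if i = 0 then star (X i *ᵥ v) ⬝ᵥ v else 0 := by
    intro i hi
    simp only [mulVec_mulVec]
    rw [← dotProduct_sum, ← sum_mulVec, hX i (Finset.mem_range.1 hi)]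
    split_ifs <;> simp
  rw [toeplitzForm, Finset.sum_congr rfl h, Finset.sum_ite_eq' _ 0, if_pos (Finset.mem_range.2 hN)]

/-- On a basis vector the hypothesis reads `δ S ≤ ‖X 0 b b‖`, where `S` dominates every `‖X i a b‖ ^
2`. Applied to `X 0 b b` itself it gives `‖X 0 b b‖ ≤ δ⁻¹`, and then the bound for all entries. It
does not depend on `N`, which is what the compactness argument needs. -/
theorem norm_le_of_inverse_column [DecidableEq ι] {X : ℕ → Matrix ι ι ℂ} {δ : ℝ} (hδ : 0 < δ)
    {N : ℕ} (hX : ∀ v : ι → ℂ, δ * ∑ i ∈ Finset.range N, ∑ a, ‖(X i *ᵥ v) a‖ ^ 2 ≤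
      (star (X 0 *ᵥ v) ⬝ᵥ v).re) {i : ℕ} (hi : i < N) (a b : ι) : ‖X i a b‖ ≤ δ⁻¹ := by
  have h := hX (Pi.single b 1)
  simp only [mulVec_single_one, dotProduct_single_one, col_apply, Pi.star_apply] at h
  have hle : ∀ i < N, ∀ a, ‖X i a b‖ ^ 2 ≤
      ∑ i ∈ Finset.range N, ∑ a, ‖X i a b‖ ^ 2 := fun i hi a =>
    (Finset.single_le_sum (f := fun a => ‖X i a b‖ ^ 2) (fun _ _ => by positivity)
      (Finset.mem_univ a)).trans
    (Finset.single_le_sum (f := fun i => ∑ a, ‖X i a b‖ ^ 2) (fun _ _ => by positivity)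
      (Finset.mem_range.2 hi))
  have hre : (star (X 0 b b)).re ≤ ‖X 0 b b‖ := (Complex.re_le_norm _).trans (norm_star _).le
  have h0 := hle 0 (by omega) b
  have h1 := hle i hi a
  set S := ∑ i ∈ Finset.range N, ∑ a, ‖X i a b‖ ^ 2
  have hS : δ * S ≤ ‖X 0 b b‖ := h.trans hre
  have hs : ‖X 0 b b‖ ≤ δ⁻¹ := by
    by_contra! hc
    have hp : 0 < ‖X 0 b b‖ := (inv_pos.2 hδ).trans hc
    have h2 : δ * ‖X 0 b b‖ ^ 2 ≤ ‖X 0 b b‖ := (mul_le_mul_of_nonneg_left h0 hδ.le).trans hS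
    have h3 : 1 < δ * ‖X 0 b b‖ := by
      rwa [inv_lt_iff_one_lt_mul₀' hδ] at hc
    nlinarith
  refine le_of_sq_le_sq ?_ (inv_pos.2 hδ).le
  have h4 : δ * ‖X i a b‖ ^ 2 ≤ δ⁻¹ := (mul_le_mul_of_nonneg_left h1 hδ.le).trans (hS.trans hs)
  calc ‖X i a b‖ ^ 2 = δ⁻¹ * (δ * ‖X i a b‖ ^ 2) := by field_simp
    _ ≤ δ⁻¹ * δ⁻¹ := mul_le_mul_of_nonneg_left h4 (inv_pos.2 hδ).le
    _ = δ⁻¹ ^ 2 := by ring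

/-- The first block column of the inverse of a half-infinite banded block Toeplitz matrix. -/
theorem exists_halfline_inverse_column [DecidableEq ι] {n : ℕ} {Q : ℤ → Matrix ι ι ℂ}
    (hQ : ∀ k, (n : ℤ) < |k| → Q k = 0) {δ : ℝ} (hδ : 0 < δ)
    (hform : ∀ N x, δ * ∑ i ∈ Finset.range N, ∑ a, ‖x i a‖ ^ 2 ≤ (toeplitzForm Q N x).re) :
    ∃ F : ℕ → Matrix ι ι ℂ,
      (∀ i : ℕ, ∑ j ∈ Finset.range (i + n + 1), Q (i - j) * F j = if i = 0 then 1 else 0) ∧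
      ∀ (M : ℕ) (v : ι → ℂ), δ * ∑ i ∈ Finset.range M, ∑ a, ‖(F i *ᵥ v) a‖ ^ 2 ≤
        (star (F 0 *ᵥ v) ⬝ᵥ v).re := by
  choose X hX using exists_toeplitz_inverse_column hδ hform
  have hXform : ∀ N, 0 < N → ∀ v : ι → ℂ,
      δ * ∑ i ∈ Finset.range N, ∑ a, ‖(X N i *ᵥ v) a‖ ^ 2 ≤ (star (X N 0 *ᵥ v) ⬝ᵥ v).re := by
    intro N hN v
    rw [← toeplitzForm_eq_of_inverse_column hN (hX N)]
    exact hform N _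
  -- A nonprincipal ultrafilter makes all the bounded entries converge at once, without a diagonal
  -- subsequence.
  set U : Ultrafilter ℕ := hyperfilter ℕ
  have hU : ∀ M : ℕ, ∀ᶠ N in (U : Filter ℕ), M < N := fun M =>
    (Nat.hyperfilter_le_atTop) (eventually_gt_atTop M)
  have hlim : ∀ i a b, ∃ y : ℂ, Tendsto (fun N => X N i a b) U (𝓝 y) := by
    intro i a b
    have hmem : Metric.closedBall (0 : ℂ) δ⁻¹ ∈ U.map fun N => X N i a b := by
      rw [Ultrafilter.mem_map]
      filter_upwards [hU i] with N hN
      simpa using norm_le_of_inverse_column hδ (hXform N (by omega)) hN a b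
    obtain ⟨y, -, hy⟩ := (isCompact_closedBall (0 : ℂ) δ⁻¹).ultrafilter_le_nhds' _ hmem
    exact ⟨y, hy⟩
  choose F hF using hlim
  have hFm : ∀ i, Tendsto (fun N => X N i) U (𝓝 (of (F i))) := fun i =>
    tendsto_pi_nhds.2 fun a => tendsto_pi_nhds.2 fun b => hF i a b
  refine ⟨fun i => of (F i), fun i => ?_, fun M v => ?_⟩
  · have h1 : Tendsto (fun N => ∑ j ∈ Finset.range (i + n + 1), Q (i - j) * X N j) U
        (𝓝 (∑ j ∈ Finset.range (i + n + 1), Q (i - j) * of (F j))) :=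
      tendsto_finsetSum _ fun j _ => tendsto_const_nhds.mul (hFm j)
    refine tendsto_nhds_unique (h1.congr' ?_) tendsto_const_nhds
    filter_upwards [hU (i + n)] with N hN
    rw [← hX N i (by omega)]
    -- By bandedness row `i` involves only `j ≤ i + n`, so for large `N` the equation is a fixed
    -- finite sum and passes to the limit.
    refine Finset.sum_subset (Finset.range_mono (by omega)) fun j _ hj => ?_
    rw [hQ, zero_mul]
    rw [Finset.mem_range] at hj
    rw [lt_abs]
    omega
  · have hv : ∀ i, Tendsto (fun N => X N i *ᵥ v) U (𝓝 (of (F i) *ᵥ v)) := fun i =>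
      ((continuous_id.matrix_mulVec continuous_const).tendsto _).comp (hFm i)
    have h1 : Tendsto (fun N => δ * ∑ i ∈ Finset.range M, ∑ a, ‖(X N i *ᵥ v) a‖ ^ 2) U
        (𝓝 (δ * ∑ i ∈ Finset.range M, ∑ a, ‖(of (F i) *ᵥ v) a‖ ^ 2)) :=
      (tendsto_finsetSum _ fun i _ => tendsto_finsetSum _ fun a _ =>
        ((tendsto_pi_nhds.1 (hv i) a).norm.pow 2)).const_mul δ
    have h2 : Tendsto (fun N => (star (X N 0 *ᵥ v) ⬝ᵥ v).re) U
        (𝓝 (star (of (F 0) *ᵥ v) ⬝ᵥ v).re) :=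
      (((Complex.continuous_re.comp (continuous_star.dotProduct continuous_const)).tendsto
        _).comp (hv 0))
    refine le_of_tendsto_of_tendsto h1 h2 ?_
    filter_upwards [hU M] with N hN
    refine le_trans (mul_le_mul_of_nonneg_left ?_ hδ.le) (hXform N (by omega) v)
    exact Finset.sum_le_sum_of_subset_of_nonneg (Finset.range_mono hN.le)
      fun _ _ _ => by positivity

/-- Entrywise, `|xy| ≤ x² + y²` gives domination by two square-summable families, one of them
shifted. -/
theorem summable_conjTranspose_mul_mul {F : ℤ → Matrix ι ι ℂ}
    (hF : ∀ a b, Summable fun i => ‖F i a b‖ ^ 2) (M : Matrix ι ι ℂ) (c : ℤ) :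
    Summable fun l => (F l)ᴴ * (M * F (l + c)) := by
  refine Pi.summable.2 fun a => Pi.summable.2 fun b => ?_
  simp only [mul_apply, conjTranspose_apply, Finset.mul_sum]
  refine summable_sum fun d _ => summable_sum fun e _ => ?_
  have h2 : Summable fun l => ‖F (l + c) e b‖ ^ 2 :=
    (Equiv.addRight c).summable_iff.2 (hF e b)
  refine Summable.of_norm_bounded (((hF d a).add h2).mul_left ‖M d e‖) fun l => ?_
  rw [norm_mul, norm_mul, norm_star, mul_left_comm]
  refine mul_le_mul_of_nonneg_left ?_ (norm_nonneg _)
  nlinarith [sq_nonneg (‖F l d a‖ - ‖F (l + c) e b‖), norm_nonneg (F l d a),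
    norm_nonneg (F (l + c) e b)]

/-- Convolution with a self-adjoint banded symbol is symmetric on square-summable sequences. -/
theorem tsum_conjTranspose_mul_conv {n : ℕ} {Q F R : ℤ → Matrix ι ι ℂ}
    (hQs : ∀ k, Q (-k) = (Q k)ᴴ) (hF : ∀ a b, Summable fun i => ‖F i a b‖ ^ 2)
    (hR : ∀ m, R m = ∑ d ∈ Finset.Icc (-(n : ℤ)) n, Q d * F (m - d)) (k : ℤ) :
    ∑' l, (F l)ᴴ * R (l + k) = ∑' i, (R (i - k))ᴴ * F i := by
  have h1 : ∀ l, (F l)ᴴ * R (l + k) =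
      ∑ d ∈ Finset.Icc (-(n : ℤ)) n, (F l)ᴴ * (Q d * F (l + (k - d))) := by
    intro l
    rw [hR, Finset.mul_sum]
    simp only [add_sub_assoc]
  have h2 : ∀ i, (R (i - k))ᴴ * F i =
      ∑ d ∈ Finset.Icc (-(n : ℤ)) n, (F (i - (k - d)))ᴴ * (Q d * F i) := by
    intro i
    rw [hR, conjTranspose_sum, Finset.sum_mul]
    refine Finset.sum_nbij' (fun d => -d) (fun d => -d) ?_ ?_ ?_ ?_ ?_
    · intro d hd; rw [Finset.mem_Icc] at *; constructor <;> linarith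
    · intro d hd; rw [Finset.mem_Icc] at *; constructor <;> linarith
    · simp
    · simp
    · intro d _
      rw [hQs, conjTranspose_mul, Matrix.mul_assoc]
      rw [show i - (k - -d) = i - k - d by ring]
  have hs : ∀ d, Summable fun l => (F l)ᴴ * (Q d * F (l + (k - d))) := fun d =>
    summable_conjTranspose_mul_mul hF _ _
  have hs' : ∀ d, Summable fun i => (F (i - (k - d)))ᴴ * (Q d * F i) := by
    intro d
    rw [← (Equiv.addRight (k - d)).summable_iff]
    convert hs d using 1
    ext1 l
    simp
  simp only [h1, h2]
  rw [Summable.tsum_finsetSum fun d _ => hs d, Summable.tsum_finsetSum fun d _ => hs' d]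
  refine Finset.sum_congr rfl fun d _ => ?_
  rw [← (Equiv.addRight (k - d)).tsum_eq fun i => (F (i - (k - d)))ᴴ * (Q d * F i)]
  simp

end FejerRiesz

/-! ### The matrix Fejér–Riesz factorization. -/

section FejerRiesz

open Matrix

variable {ι : Type*} [Fintype ι]

theorem sum_range_toeplitz_eq_conv {n : ℕ} {Q F : ℤ → Matrix ι ι ℂ}
    (hQ : ∀ k, (n : ℤ) < |k| → Q k = 0) (hF : ∀ m < 0, F m = 0) (i : ℕ) :
    ∑ j ∈ Finset.range (i + n + 1), Q (i - j) * F j =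
      ∑ d ∈ Finset.Icc (-(n : ℤ)) n, Q d * F (i - d) := by
  refine Finset.sum_bij_ne_zero (fun j _ _ => (i : ℤ) - j) ?_ ?_ ?_ ?_
  · intro j _ hne
    rw [Finset.mem_Icc, ← abs_le]
    by_contra! h
    exact hne (by rw [hQ _ h, zero_mul])
  · intro j _ _ j' _ _ h
    omega
  · intro d hd hne
    rw [Finset.mem_Icc] at hd
    have hdi : d ≤ i := by
      by_contra! h
      exact hne (by rw [hF _ (by omega), mul_zero])
    have hd' : ((i - d).toNat : ℤ) = i - d := Int.toNat_of_nonneg (by omega)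
    refine ⟨(i - d).toNat, Finset.mem_range.2 (by omega), ?_, ?_⟩
    · rw [hd', sub_sub_cancel]
      exact hne
    · simp only [hd', sub_sub_cancel]
  · intro j _ _
    simp only [sub_sub_cancel]

/-- A square-summable one-sided solution `F` of `Q * F = δ₀` on the half-line, the residual `R`
being supported on nonpositive indices. -/
theorem exists_square_summable_inverse_column [DecidableEq ι] {n : ℕ} {Q : ℤ → Matrix ι ι ℂ}
    (hQ : ∀ k, (n : ℤ) < |k| → Q k = 0) {δ : ℝ} (hδ : 0 < δ)
    (hform : ∀ N x, δ * ∑ i ∈ Finset.range N, ∑ a, ‖x i a‖ ^ 2 ≤ (toeplitzForm Q N x).re) :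
    ∃ F : ℤ → Matrix ι ι ℂ, (∀ m < 0, F m = 0) ∧
      (∀ i : ℕ, ∑ d ∈ Finset.Icc (-(n : ℤ)) n, Q d * F (i - d) = if i = 0 then 1 else 0) ∧
      (∀ a b, Summable fun i => ‖F i a b‖ ^ 2) ∧
      ∀ v : ι → ℂ, v ≠ 0 → 0 < (star (F 0 *ᵥ v) ⬝ᵥ v).re := by
  obtain ⟨G, hG, hGform⟩ := exists_halfline_inverse_column hQ hδ hform
  let F : ℤ → Matrix ι ι ℂ := fun m => if 0 ≤ m then G m.toNat else 0
  have hFG : ∀ i : ℕ, F i = G i := fun i => by simp [F]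
  have hF : ∀ m < 0, F m = 0 := fun m hm => if_neg (not_le.2 hm)
  have hF0 : F 0 = G 0 := hFG 0
  have hconv : ∀ i : ℕ, ∑ d ∈ Finset.Icc (-(n : ℤ)) n, Q d * F (i - d) = if i = 0 then 1 else 0 := by
    intro i
    rw [← sum_range_toeplitz_eq_conv hQ hF, ← hG i]
    simp only [hFG]
  refine ⟨F, hF, hconv, fun a b => ?_, fun v hv => ?_⟩
  · have hinj : Function.Injective (fun i : ℕ => (i : ℤ)) := Nat.cast_injective
    rw [← hinj.summable_iff]
    · refine summable_of_sum_range_le (c := δ⁻¹ * (star (G 0 *ᵥ Pi.single b 1) ⬝ᵥ Pi.single b 1).re)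
        (fun _ => sq_nonneg _) fun M => ?_
      rw [← div_eq_inv_mul, le_div_iff₀ hδ, mul_comm]
      refine le_trans (mul_le_mul_of_nonneg_left ?_ hδ.le) (hGform M (Pi.single b 1))
      refine Finset.sum_le_sum fun i _ => ?_
      simp only [mulVec_single_one, col_apply, Function.comp_apply, hFG]
      exact Finset.single_le_sum (f := fun a => ‖G i a b‖ ^ 2) (fun _ _ => by positivity)
        (Finset.mem_univ a)
    · intro m hm
      have : m < 0 := by
        by_contra! h
        exact hm ⟨m.toNat, Int.toNat_of_nonneg h⟩
      simp [hF m this]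
  · rw [hF0]
    -- Row `0` of the equation involves only `G 0, …, G n`. If all of these killed `v`, that row
    -- would give `v = 0`; hence the strict inequality.
    have h := hGform (n + 1) v
    have hS : 0 ≤ ∑ i ∈ Finset.range (n + 1), ∑ a, ‖(G i *ᵥ v) a‖ ^ 2 := by positivity
    refine lt_of_lt_of_le (mul_pos hδ (lt_of_le_of_ne hS fun h0 => hv ?_)) h
    have h1 : ∀ i ∈ Finset.range (n + 1), G i *ᵥ v = 0 := by
      intro i hi
      have h2 := (Finset.sum_eq_zero_iff_of_nonneg (fun _ _ => by positivity)).1 h0.symm i hi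
      rw [Finset.sum_eq_zero_iff_of_nonneg (fun _ _ => by positivity)] at h2
      ext a
      simpa using h2 a (Finset.mem_univ _)
    have h3 := hG 0
    rw [if_pos rfl, zero_add] at h3
    rw [← one_mulVec v, ← h3, sum_mulVec]
    refine Finset.sum_eq_zero fun i hi => ?_
    rw [← mulVec_mulVec, h1 i hi, mulVec_zero]

theorem sum_antidiagonal_eq_sum_range {E : Type*} [AddCommMonoid E] {n K : ℕ} {g : ℕ → ℕ → E}
    (hg : ∀ s t, n < s ∨ n < t → g s t = 0) :
    ∑ p ∈ Finset.HasAntidiagonal.antidiagonal K, g p.1 p.2 =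
      ∑ s ∈ Finset.range (n + 1), ∑ t ∈ Finset.range (n + 1), if s + t = K then g s t else 0 := by
  rw [← Finset.sum_product', ← Finset.sum_filter]
  symm
  refine Finset.sum_subset (fun p hp => ?_) fun p hp hp' => hg _ _ ?_
  · rw [Finset.mem_filter] at hp
    exact Finset.HasAntidiagonal.mem_antidiagonal.2 hp.2
  · rw [Finset.HasAntidiagonal.mem_antidiagonal] at hp
    rw [Finset.mem_filter, Finset.mem_product, Finset.mem_range, Finset.mem_range] at hp'
    by_contra! h
    exact hp' ⟨⟨by omega, by omega⟩, hp⟩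

open scoped ComplexOrder MatrixOrder Matrix.Norms.L2Operator in
theorem Matrix.PosSemidef.exists_eq_conjTranspose_mul_self [DecidableEq ι] {M : Matrix ι ι ℂ}
    (hM : M.PosSemidef) : ∃ B : Matrix ι ι ℂ, M = Bᴴ * B :=
  CStarAlgebra.nonneg_iff_eq_star_mul_self.1 hM.nonneg

open scoped ComplexOrder in
/-- The matrix Fejér–Riesz theorem for a strictly positive trigonometric polynomial `∑ zᵏ Qₖ`. -/
theorem exists_fejerRiesz_factorization [DecidableEq ι] {n : ℕ} {Q : ℤ → Matrix ι ι ℂ}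
    (hQ : ∀ k, (n : ℤ) < |k| → Q k = 0) (hQs : ∀ k, Q (-k) = (Q k)ᴴ) {δ : ℝ} (hδ : 0 < δ)
    (hpos : ∀ (z : Circle) (v : ι → ℂ),
      δ * ∑ a, ‖v a‖ ^ 2 ≤ (star v ⬝ᵥ (trigSum n Q z *ᵥ v)).re) :
    ∃ A : ℕ → Matrix ι ι ℂ, ∀ k, Q k = ∑ i ∈ Finset.range (n + 1), ∑ j ∈ Finset.range (n + 1),
      if (j : ℤ) - i = k then (A i)ᴴ * A j else 0 := by
  obtain ⟨F, hF, hFQ, hFs, hFpos⟩ :=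
    exists_square_summable_inverse_column hQ hδ (le_toeplitzForm_re hQ hpos)
  set R : ℤ → Matrix ι ι ℂ := fun m => ∑ d ∈ Finset.Icc (-(n : ℤ)) n, Q d * F (m - d) with hR
  have hR0 : R 0 = 1 := hFQ 0
  have hRpos : ∀ m, 0 < m → R m = 0 := by
    intro m hm
    have h := hFQ m.toNat
    rw [Int.toNat_of_nonneg hm.le, if_neg (by omega)] at h
    exact h
  have hRneg : ∀ m, m < -(n : ℤ) → R m = 0 := by
    intro m hm
    refine Finset.sum_eq_zero fun d hd => ?_
    rw [Finset.mem_Icc] at hd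
    rw [hF _ (by omega), mul_zero]
  -- `F l` vanishes for `l < 0` and `R (l + k)` for `l > 0`, so only `l = 0` contributes.
  have hleft : ∀ k : ℕ, ∑' l, (F l)ᴴ * R (l + k) = if k = 0 then (F 0)ᴴ else 0 := by
    intro k
    rw [tsum_eq_single 0]
    · by_cases hk : k = 0
      · simp [hk, hR0]
      · rw [if_neg hk, hRpos _ (by omega), mul_zero]
    · intro l hl
      rcases lt_or_gt_of_ne hl with h | h
      · simp [hF l h]
      · rw [hRpos _ (by omega), mul_zero]
  -- The same two supports confine `i` to `0, …, k`, turning the sum into a coefficient of a product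
  -- of power series.
  have hright : ∀ k : ℕ, ∑' i, (R (i - k))ᴴ * F i =
      ∑ p ∈ Finset.HasAntidiagonal.antidiagonal k, (R (-(p.1 : ℤ)))ᴴ * F p.2 := by
    intro k
    have hinj : Function.Injective (fun i : ℕ => (i : ℤ)) := Nat.cast_injective
    rw [Finset.Nat.sum_antidiagonal_eq_sum_range_succ_mk, ← hinj.tsum_eq,
      tsum_eq_sum (s := Finset.range k.succ), ← Finset.sum_range_reflect]
    · refine Finset.sum_congr rfl fun i hi => ?_
      rw [Finset.mem_range] at hi
      have h1 : ((k.succ - 1 - i : ℕ) : ℤ) = k - i := by omega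
      have h2 : k - i = k.succ - 1 - i := by omega
      simp only [h1, h2]
      rw [show (k : ℤ) - i - k = -i by ring]
    · intro i hi
      rw [Finset.mem_range] at hi
      rw [hRpos _ (by omega), conjTranspose_zero, zero_mul]
    · intro m hm
      by_contra h
      refine hm ?_
      change (R (m - k))ᴴ * F m = 0
      rw [hF m, mul_zero]
      by_contra! h0
      exact h ⟨m.toNat, Int.toNat_of_nonneg h0⟩
  have hconv : ∀ k : ℕ, ∑ p ∈ Finset.HasAntidiagonal.antidiagonal k, (R (-(p.1 : ℤ)))ᴴ * F p.2 =
      if k = 0 then (F 0)ᴴ else 0 := fun k => by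
    rw [← hleft, ← hright, tsum_conjTranspose_mul_conv hQs hFs fun m => rfl]
  have hHerm : (F 0).IsHermitian := by
    have := hconv 0
    simp [hR0] at this
    exact this.symm
  have hD : (F 0).PosDef := by
    refine .of_dotProduct_mulVec_pos hHerm fun v hv => ?_
    have h1 : star v ⬝ᵥ (F 0 *ᵥ v) = star (F 0 *ᵥ v) ⬝ᵥ v := by
      rw [star_mulVec, hHerm.eq, dotProduct_mulVec]
    have h2 : star (star v ⬝ᵥ (F 0 *ᵥ v)) = star v ⬝ᵥ (F 0 *ᵥ v) := by
      rw [← star_dotProduct, h1]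
    rw [Complex.pos_iff]
    refine ⟨h1 ▸ hFpos v hv, ?_⟩
    exact (Complex.conj_eq_iff_im.1 h2).symm
  obtain ⟨B, hB⟩ := hD.inv.posSemidef.exists_eq_conjTranspose_mul_self
  have hunit : IsUnit (F 0) := hD.isUnit
  let Φ : PowerSeries (Matrix ι ι ℂ) := PowerSeries.mk fun i => F i
  let Ψ : PowerSeries (Matrix ι ι ℂ) := PowerSeries.mk fun i => (F 0)⁻¹ * (R (-(i : ℤ)))ᴴ
  let q : PowerSeries (Matrix ι ι ℂ) := PowerSeries.mk fun i => Q (i - n)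
  have hΨΦ : Ψ * Φ = 1 := by
    ext1 k
    rw [PowerSeries.coeff_mul, PowerSeries.coeff_one]
    simp only [Φ, Ψ, PowerSeries.coeff_mk, Matrix.mul_assoc]
    rw [← Finset.mul_sum, hconv, hHerm.eq]
    split_ifs
    · exact nonsing_inv_mul _ ((isUnit_iff_isUnit_det _).1 hunit)
    · rw [mul_zero]
  -- The constant coefficient `F 0` of `Φ` is a unit, so `Φ` has a right inverse, which must agree
  -- with the left inverse `Ψ`.
  have hΦΨ : Φ * Ψ = 1 := by
    have h1 := PowerSeries.mul_invOfUnit Φ hunit.unit (by simp [Φ])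
    have h2 : PowerSeries.invOfUnit Φ hunit.unit = Ψ := by
      rw [← one_mul (PowerSeries.invOfUnit _ _), ← hΨΦ, mul_assoc, h1, mul_one]
    rw [← h2, h1]
  -- The shift by `n` moves the supports of `Q` and `R` into the nonnegative indices, so that `Q * F
  -- = R` becomes an identity of power series.
  have hqΦ : q * Φ = PowerSeries.mk fun i => R (i - n) := by
    ext1 k
    rw [PowerSeries.coeff_mul, PowerSeries.coeff_mk]
    simp only [q, Φ, PowerSeries.coeff_mk, hR]
    refine Finset.sum_bij_ne_zero (fun p _ _ => (p.1 : ℤ) - n) ?_ ?_ ?_ ?_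
    · intro p _ hne
      rw [Finset.mem_Icc, ← abs_le]
      by_contra! h
      exact hne (by rw [hQ _ h, zero_mul])
    · intro p hp _ p' hp' _ h
      rw [Finset.HasAntidiagonal.mem_antidiagonal] at hp hp'
      ext <;> omega
    · intro d hd hne
      rw [Finset.mem_Icc] at hd
      have hdi : d ≤ k - n := by
        by_contra! h
        exact hne (by rw [hF _ (by omega), mul_zero])
      have h1 : ((d + n).toNat : ℤ) = d + n := Int.toNat_of_nonneg (by omega)
      have h2 : ((k - n - d).toNat : ℤ) = k - n - d := Int.toNat_of_nonneg (by omega)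
      refine ⟨((d + n).toNat, (k - n - d).toNat), Finset.HasAntidiagonal.mem_antidiagonal.2 (by omega), ?_, ?_⟩
      · simp only [h1, h2, add_sub_cancel_right]
        exact hne
      · simp only [h1, add_sub_cancel_right]
    · intro p hp _
      rw [Finset.HasAntidiagonal.mem_antidiagonal] at hp
      congr 2
      omega
  -- Cancelling `Φ` gives `Q = R F₀⁻¹ R*`. With `F₀⁻¹ = Bᴴ * B`, the term `R (-i) * F₀⁻¹ * (R
  -- (-j))ᴴ` is `(A i)ᴴ * A j`.
  refine ⟨fun i => B * (R (-(i : ℤ)))ᴴ, fun k => ?_⟩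
  by_cases hk : |k| ≤ n
  · rw [abs_le] at hk
    have hk' : ((k + n).toNat : ℤ) = k + n := Int.toNat_of_nonneg (by omega)
    have h1 : PowerSeries.coeff (k + n).toNat q = Q k := by
      simp only [q, PowerSeries.coeff_mk, hk', add_sub_cancel_right]
    rw [← h1, ← mul_one q, ← hΦΨ, ← mul_assoc, hqΦ, PowerSeries.coeff_mul]
    simp only [Ψ, PowerSeries.coeff_mk]
    rw [sum_antidiagonal_eq_sum_range (n := n)
      (g := fun s t => R (s - n) * ((F 0)⁻¹ * (R (-(t : ℤ)))ᴴ)), ← Finset.sum_range_reflect]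
    · refine Finset.sum_congr rfl fun i hi => Finset.sum_congr rfl fun j hj => ?_
      rw [Finset.mem_range] at hi
      have h2 : ((n + 1 - 1 - i : ℕ) : ℤ) = n - i := by omega
      refine if_congr (by omega) ?_ rfl
      rw [h2, show (n : ℤ) - i - n = -i by ring, hB, conjTranspose_mul,
        conjTranspose_conjTranspose]
      simp only [Matrix.mul_assoc]
    · rintro s t (h | h)
      · rw [hRpos _ (by omega), zero_mul]
      · rw [hRneg (-(t : ℤ)) (by omega), conjTranspose_zero, mul_zero, mul_zero]
  · rw [hQ k (not_le.1 hk)]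
    symm
    refine Finset.sum_eq_zero fun i hi => Finset.sum_eq_zero fun j hj => if_neg fun h => hk ?_
    rw [Finset.mem_range] at hi hj
    rw [abs_le]
    omega

end FejerRiesz

/-! ### Scalar factorization and the Cesàro correction. -/

theorem trigSum_smul_of_eq_sum {E : Type*} [AddCommGroup E] [Module ℂ E] {n : ℕ} {Q : ℤ → E}
    {g : ℕ → ℕ → E} (hQ : ∀ k, Q k = ∑ i ∈ Finset.range (n + 1), ∑ j ∈ Finset.range (n + 1),
      if (j : ℤ) - i = k then g i j else 0) (u : ℤ → ℂ) (z : Circle) :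
    trigSum n (fun k => u k • Q k) z = ∑ i ∈ Finset.range (n + 1), ∑ j ∈ Finset.range (n + 1),
      ((z : ℂ) ^ ((j : ℤ) - i) * u (j - i)) • g i j := by
  simp only [trigSum, hQ, Finset.smul_sum]
  rw [Finset.sum_comm]
  refine Finset.sum_congr rfl fun i hi => ?_
  rw [Finset.sum_comm]
  refine Finset.sum_congr rfl fun j hj => ?_
  rw [Finset.mem_range] at hi hj
  rw [Finset.sum_eq_single ((j : ℤ) - i)]
  · rw [if_pos rfl, mul_smul]
  · intro k _ hk
    rw [if_neg hk.symm, smul_zero, smul_zero]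
  · intro h
    refine absurd (Finset.mem_Icc.2 ?_) h
    omega

open Matrix in
theorem le_re_symbol_of_le_trigSum {n : ℕ} {a : ℤ → ℂ} {δ : ℝ} {z : Circle}
    (h : δ ≤ (trigSum n a z).re) (v : Unit → ℂ) :
    δ * ∑ i, ‖v i‖ ^ 2 ≤
      (star v ⬝ᵥ (trigSum n (fun k => (of fun _ _ => a k : Matrix Unit Unit ℂ)) z *ᵥ v)).re := by
  have h1 : (trigSum n (fun k => of fun _ _ => a k) z : Matrix Unit Unit ℂ) =
      of fun _ _ => trigSum n a z := by
    ext; simp [trigSum, Matrix.sum_apply]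
  have h2 : star (v ()) * (trigSum n a z * v ()) = ((‖v ()‖ ^ 2 : ℝ) : ℂ) * trigSum n a z := by
    rw [mul_left_comm, Complex.star_def, Complex.conj_mul', mul_comm]
    push_cast
    rfl
  rw [h1]
  simp only [Finset.univ_unique, Finset.sum_singleton, dotProduct, mulVec, of_apply,
    Pi.star_apply, PUnit.default_eq_unit]
  rw [h2, Complex.re_ofReal_mul, mul_comm]
  exact mul_le_mul_of_nonneg_left h (sq_nonneg _)

/-- The scalar Fejér–Riesz theorem for a strictly positive trigonometric polynomial. -/
theorem exists_scalar_fejerRiesz_factorization {n : ℕ} {a : ℤ → ℂ}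
    (ha : ∀ k, (n : ℤ) < |k| → a k = 0) (has : ∀ k, a (-k) = star (a k)) {δ : ℝ} (hδ : 0 < δ)
    (hpos : ∀ z, δ ≤ (trigSum n a z).re) :
    ∃ q : ℕ → ℂ, ∀ k, a k = ∑ i ∈ Finset.range (n + 1), ∑ j ∈ Finset.range (n + 1),
      if (j : ℤ) - i = k then star (q i) * q j else 0 := by
  obtain ⟨A, hA⟩ := exists_fejerRiesz_factorization (ι := Unit)
    (Q := fun k => Matrix.of fun _ _ => a k) (n := n) (fun k hk => by ext; simp [ha k hk])
    (fun k => by ext; simp [has]) hδ (fun z => le_re_symbol_of_le_trigSum (hpos z))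
  refine ⟨fun i => A i () (), fun k => ?_⟩
  have h := congrFun (congrFun (hA k) ()) ()
  rw [Matrix.of_apply] at h
  rw [h, Matrix.sum_apply]
  refine Finset.sum_congr rfl fun i _ => ?_
  rw [Matrix.sum_apply]
  refine Finset.sum_congr rfl fun j _ => ?_
  split_ifs <;> simp [Matrix.mul_apply]

/-- With `n = i + t` the sum is `(i(i+1) + t(t+1)) / 2`, which falls short of the bound by exactly
`i t`. Equality holds at the ends `i = 0` and `i = n`. -/
theorem sum_range_abs_sub_le {n i : ℕ} (hi : i ≤ n) :
    ∑ j ∈ Finset.range (n + 1), |(j : ℝ) - i| ≤ n * (n + 1) / 2 := by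
  have hbase : ∀ k ≤ i + 1, ∑ j ∈ Finset.range k, |(j : ℝ) - i| = k * i - k * (k - 1) / 2 := by
    intro k
    induction k with
    | zero => simp
    | succ k ih =>
      intro hk
      have : (k : ℝ) ≤ i := by exact_mod_cast Nat.le_of_succ_le_succ hk
      rw [Finset.sum_range_succ, ih (by omega), abs_of_nonpos (by linarith)]
      push_cast
      ring
  have hstep : ∀ t : ℕ, ∑ j ∈ Finset.range (i + t + 1), |(j : ℝ) - i| =
      (i * (i + 1) + t * (t + 1)) / 2 := by
    intro t
    induction t with
    | zero =>
      rw [add_zero, hbase _ le_rfl]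
      push_cast
      ring
    | succ t ih =>
      rw [← add_assoc, Finset.sum_range_succ, ih, abs_of_nonneg (by push_cast; linarith)]
      push_cast
      ring
  obtain ⟨t, rfl⟩ := Nat.exists_eq_add_of_le hi
  rw [hstep]
  push_cast
  have : (0 : ℝ) ≤ i * t := by positivity
  nlinarith

/-- The correction `∑ |k| / (m + 1 - |k|) aₖ zᵏ` turning Cesàro means of a positive trigonometric
polynomial into the polynomial itself is bounded below in terms of the mean value `a₀`. -/
theorem le_re_trigSum_cesaro_correction {n m : ℕ} (hnm : n < m) {a : ℤ → ℂ}
    (ha : ∀ k, (n : ℤ) < |k| → a k = 0) (has : ∀ k, a (-k) = star (a k)) {δ : ℝ} (hδ : 0 < δ)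
    (hpos : ∀ z, δ ≤ (trigSum n a z).re) (z : Circle) :
    -((n : ℝ) * (n + 1) * (a 0).re / (2 * (m - n))) ≤
      (trigSum n (fun k => ((|(k : ℝ)| / (m + 1 - |(k : ℝ)|) : ℝ) : ℂ) • a k) z).re := by
  obtain ⟨q, hq⟩ := exists_scalar_fejerRiesz_factorization ha has hδ hpos
  have hmn : (0 : ℝ) < m - n := sub_pos.2 (by exact_mod_cast hnm)
  have h0 : (a 0).re = ∑ i ∈ Finset.range (n + 1), ‖q i‖ ^ 2 := by
    rw [hq, Complex.re_sum]
    refine Finset.sum_congr rfl fun i hi => ?_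
    rw [Finset.sum_eq_single i]
    · rw [sub_self, if_pos rfl, Complex.star_def, Complex.conj_mul', ← Complex.ofReal_pow,
        Complex.ofReal_re]
    · intro j _ hj
      exact if_neg (by omega)
    · exact fun h => absurd hi h
  -- Since `|j - i| ≤ n`, the denominator is at least `m - n`. The arithmetic–geometric mean
  -- inequality splits `‖q i‖ ‖q j‖` into two halves, which contribute equally after summation over
  -- `i` and `j`.
  have hterm : ∀ i ∈ Finset.range (n + 1), ∀ j ∈ Finset.range (n + 1),
      -(|(j : ℝ) - i| * ‖q i‖ ^ 2 / (2 * (m - n)) + |(i : ℝ) - j| * ‖q j‖ ^ 2 / (2 * (m - n))) ≤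
      (((z : ℂ) ^ ((j : ℤ) - i) *
        ((|(((j : ℤ) - i : ℤ) : ℝ)| / (m + 1 - |(((j : ℤ) - i : ℤ) : ℝ)|) : ℝ) : ℂ)) •
          (star (q i) * q j)).re := by
    intro i hi j hj
    rw [Finset.mem_range] at hi hj
    have hle : |(j : ℝ) - i| ≤ n := by
      have h1 : (i : ℝ) ≤ n := by exact_mod_cast Nat.le_of_lt_succ hi
      have h2 : (j : ℝ) ≤ n := by exact_mod_cast Nat.le_of_lt_succ hj
      have h3 : (0 : ℝ) ≤ i := by positivity
      have h4 : (0 : ℝ) ≤ j := by positivity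
      rw [abs_le]
      constructor <;> linarith
    refine le_trans ?_ (neg_le_of_abs_le (Complex.abs_re_le_norm _))
    rw [neg_le_neg_iff, norm_smul, norm_mul, norm_zpow, Circle.norm_coe, one_zpow, one_mul,
      norm_mul, norm_star, Complex.norm_real, abs_sub_comm (i : ℝ) j]
    push_cast
    have hden : 0 < (m : ℝ) + 1 - |(j : ℝ) - i| := by linarith
    rw [Real.norm_of_nonneg (by positivity)]
    calc |(j : ℝ) - i| / (m + 1 - |(j : ℝ) - i|) * (‖q i‖ * ‖q j‖)
        ≤ |(j : ℝ) - i| / (m - n) * ((‖q i‖ ^ 2 + ‖q j‖ ^ 2) / 2) := by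
          gcongr
          · linarith
          · nlinarith [sq_nonneg (‖q i‖ - ‖q j‖)]
      _ = _ := by field_simp
  rw [trigSum_smul_of_eq_sum hq, Complex.re_sum]
  simp only [Complex.re_sum]
  refine le_trans ?_ (Finset.sum_le_sum fun i hi => Finset.sum_le_sum fun j hj => hterm i hi j hj)
  simp only [Finset.sum_neg_distrib, Finset.sum_add_distrib]
  rw [neg_le_neg_iff, Finset.sum_comm (f := fun i j : ℕ => |(i : ℝ) - j| * ‖q j‖ ^ 2 / (2 * (m - n)))]
  have hrow : ∑ i ∈ Finset.range (n + 1), ∑ j ∈ Finset.range (n + 1),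
      |(j : ℝ) - i| * ‖q i‖ ^ 2 / (2 * (m - n)) ≤
      ∑ i ∈ Finset.range (n + 1), (n * (n + 1) / 2) * (‖q i‖ ^ 2 / (2 * (m - n))) := by
    refine Finset.sum_le_sum fun i hi => ?_
    simp only [mul_div_assoc]
    rw [← Finset.sum_mul]
    refine mul_le_mul_of_nonneg_right ?_ (by positivity)
    rw [← mul_div_assoc]
    exact sum_range_abs_sub_le (Nat.le_of_lt_succ (Finset.mem_range.1 hi))
  refine (add_le_add hrow hrow).trans (le_of_eq ?_)
  rw [← Finset.mul_sum, ← Finset.sum_div, ← h0]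
  ring

/-! ### Summation along the diagonals of a Toeplitz matrix. -/

theorem sum_range_sum_range_sub {E : Type*} [AddCommMonoid E] {n m : ℕ} (hnm : n ≤ m) {f : ℤ → E}
    (hf : ∀ k, (n : ℤ) < |k| → f k = 0) :
    ∑ i ∈ Finset.range (m + 1), ∑ j ∈ Finset.range (m + 1), f (i - j) =
      ∑ k ∈ Finset.Icc (-(n : ℤ)) n, (m + 1 - k.natAbs) • f k := by
  have h1 : ∀ i j : ℕ, f (i - j) =
      ∑ k ∈ Finset.Icc (-(n : ℤ)) n, if (i : ℤ) = j + k then f k else 0 := by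
    intro i j
    rw [Finset.sum_congr rfl fun k _ => if_congr (P := (i : ℤ) = j + k) (Q := k = i - j)
      (by omega) rfl rfl, Finset.sum_ite_eq']
    split_ifs with h
    · rfl
    · rw [Finset.mem_Icc, ← abs_le] at h
      exact hf _ (not_le.1 h)
  simp only [h1]
  have h2 : ∀ i ∈ Finset.range (m + 1), ∑ j ∈ Finset.range (m + 1),
      ∑ k ∈ Finset.Icc (-(n : ℤ)) n, (if (i : ℤ) = j + k then f k else 0) =
      ∑ k ∈ Finset.Icc (-(n : ℤ)) n, ∑ j ∈ Finset.range (m + 1),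
        if (i : ℤ) = j + k then f k else 0 := fun i _ => Finset.sum_comm
  rw [Finset.sum_congr rfl h2, Finset.sum_comm]
  refine Finset.sum_congr rfl fun k hk => ?_
  rw [Finset.mem_Icc] at hk
  rw [← Finset.sum_product', ← Finset.sum_filter, Finset.sum_const]
  congr 1
  rw [← Finset.card_range (m + 1 - k.natAbs)]
  -- The `k`-th diagonal starts at `(k⁺, k⁻)`; its points are numbered by their distance from that
  -- start.
  refine Finset.card_nbij' (fun p => p.2 - (-k).toNat) (fun j => (j + k.toNat, j + (-k).toNat))
    ?_ ?_ ?_ ?_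
  · intro p hp
    simp only [Finset.coe_filter, Finset.mem_product, Finset.mem_range, Set.mem_ofPred_eq,
      Finset.coe_range, Set.mem_Iio] at hp ⊢
    omega
  · intro j hj
    simp only [Finset.coe_filter, Finset.mem_product, Finset.mem_range, Set.mem_ofPred_eq,
      Finset.coe_range, Set.mem_Iio] at hj ⊢
    omega
  · intro p hp
    simp only [Finset.coe_filter, Finset.mem_product, Finset.mem_range, Set.mem_ofPred_eq] at hp
    ext <;> simp only <;> omega
  · intro j _
    simp

/-! ### Laurent polynomials as trigonometric sums, and the Gram matrix of `P`. -/

theorem torusEval₁_eq_trigSum {p : ℂ[T;T⁻¹]} {n : ℕ} (hp : ∀ l : ℤ, (n : ℤ) < |l| → p.coeff l = 0)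
    (z : Circle) : torusEval₁ p z = trigSum n p.coeff z := by
  unfold torusEval₁ trigSum
  rw [Finsupp.sum_of_support_subset (s := Finset.Icc (-(n : ℤ)) n)]
  · exact Finset.sum_congr rfl fun l _ => mul_comm _ _
  · intro l hl
    rw [Finset.mem_Icc, ← abs_le]
    by_contra! h
    exact (Finsupp.mem_support_iff.1 hl) (hp l h)
  · simp

theorem torusEval₂_eq_trigSum {P : ℂ[T;T⁻¹][T;T⁻¹]} {n : ℕ}
    (hP : ∀ k : ℤ, (n : ℤ) < |k| → P.coeff k = 0) (z₁ z₂ : Circle) :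
    torusEval₂ P z₁ z₂ = trigSum n (fun k => torusEval₁ (P.coeff k) z₂) z₁ := by
  unfold torusEval₂ trigSum
  rw [Finsupp.sum_of_support_subset (s := Finset.Icc (-(n : ℤ)) n)]
  · exact Finset.sum_congr rfl fun l _ => mul_comm _ _
  · intro l hl
    rw [Finset.mem_Icc, ← abs_le]
    by_contra! h
    exact (Finsupp.mem_support_iff.1 hl) (hP l h)
  · simp [torusEval₁]

/-- The coefficients of a trigonometric polynomial with real values are Hermitian. -/
theorem coeff_neg_eq_star_of_im_eq_zero {n : ℕ} {a : ℤ → ℂ}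
    (ha : ∀ k, (n : ℤ) < |k| → a k = 0) (h : ∀ z, (trigSum n a z).im = 0) (k : ℤ) :
    a (-k) = star (a k) := by
  have h1 : a = fun k => star (a (-k)) := by
    refine coeff_eq_of_trigSum_eq ha (fun k hk => ?_) fun z => ?_
    · rw [ha _ (by rwa [abs_neg]), star_zero]
    · rw [← star_trigSum]
      exact (Complex.conj_eq_iff_im.2 (h z)).symm
  rw [congrFun h1 (-k), neg_neg]

open Matrix in
theorem conjTranspose_mul_self_eq_trigSum {ι : Type*} [Fintype ι] {n : ℕ} {Q : ℤ → Matrix ι ι ℂ}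
    {A : ℕ → Matrix ι ι ℂ} (hA : ∀ k, Q k = ∑ i ∈ Finset.range (n + 1),
      ∑ j ∈ Finset.range (n + 1), if (j : ℤ) - i = k then (A i)ᴴ * A j else 0) (z : Circle) :
    (∑ j ∈ Finset.range (n + 1), (z : ℂ) ^ j • A j)ᴴ *
      (∑ j ∈ Finset.range (n + 1), (z : ℂ) ^ j • A j) = trigSum n Q z := by
  have h := trigSum_smul_of_eq_sum hA (fun _ => 1) z
  simp only [one_smul, mul_one] at h
  rw [h, conjTranspose_sum, Finset.sum_mul_sum]
  refine Finset.sum_congr rfl fun i _ => Finset.sum_congr rfl fun j _ => ?_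
  rw [conjTranspose_smul, smul_mul_smul_comm, ← zpow_natCast, ← zpow_natCast, Circle.star_zpow,
    ← zpow_add₀ (Circle.coe_ne_zero z), neg_add_eq_sub]

open Matrix in
/-- The Toeplitz matrix of Cesàro-corrected coefficients `aₖ / (m + 1 - |k|)` is positive definite
as soon as `m` is large compared with the degree of `∑ aₖ zᵏ`. -/
theorem le_re_cesaro_toeplitz {n m : ℕ} (hnm : n < m) {a : ℤ → ℂ}
    (ha : ∀ k, (n : ℤ) < |k| → a k = 0) (has : ∀ k, a (-k) = star (a k)) {ε C : ℝ} (hε : 0 < ε)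
    (hpos : ∀ z, ε ≤ (trigSum n a z).re) (hC : ‖a 0‖ ≤ C) (v : Fin (m + 1) → ℂ) :
    (ε - n * (n + 1) * C / (2 * (m - n))) / (m + 1) * ∑ i, ‖v i‖ ^ 2 ≤
      (star v ⬝ᵥ (of (fun i j : Fin (m + 1) =>
        (((m + 1 - |((i : ℕ) : ℝ) - (j : ℕ)|)⁻¹ : ℝ) : ℂ) * a (i - j)) *ᵥ v)).re := by
  have hmn : (0 : ℝ) < m - n := sub_pos.2 (by exact_mod_cast hnm)
  set b : ℤ → ℂ := fun k => (((m + 1 - |(k : ℝ)|)⁻¹ : ℝ) : ℂ) * a k with hb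
  have hb0 : ∀ k, (n : ℤ) < |k| → b k = 0 := fun k hk => by simp [hb, ha k hk]
  -- This is `(m + 1) / (m + 1 - |k|) = 1 + |k| / (m + 1 - |k|)`, coefficient by coefficient.
  have hsplit : ∀ z, ((m + 1 : ℝ) : ℂ) * trigSum n b z = trigSum n a z +
      trigSum n (fun k => ((|(k : ℝ)| / (m + 1 - |(k : ℝ)|) : ℝ) : ℂ) • a k) z := by
    intro z
    simp only [trigSum, Finset.mul_sum, ← Finset.sum_add_distrib, hb, smul_eq_mul]
    refine Finset.sum_congr rfl fun k hk => ?_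
    rw [Finset.mem_Icc, ← abs_le] at hk
    have hk' : |(k : ℝ)| ≤ n := by exact_mod_cast hk
    have hd : (m : ℝ) + 1 - |(k : ℝ)| ≠ 0 := by linarith
    have h1 : ((m + 1 : ℝ) : ℂ) * (((m + 1 - |(k : ℝ)|)⁻¹ : ℝ) : ℂ) =
        1 + ((|(k : ℝ)| / (m + 1 - |(k : ℝ)|) : ℝ) : ℂ) := by
      rw [← Complex.ofReal_mul, ← Complex.ofReal_one, ← Complex.ofReal_add]
      congr 1
      field_simp
      ring
    linear_combination (z : ℂ) ^ k * a k * h1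
  have hbpos : ∀ z, (ε - n * (n + 1) * C / (2 * (m - n))) / (m + 1) ≤ (trigSum n b z).re := by
    intro z
    rw [div_le_iff₀' (by positivity), ← Complex.re_ofReal_mul, hsplit, Complex.add_re]
    have h1 := le_re_trigSum_cesaro_correction hnm ha has hε hpos z
    have h2 : (n : ℝ) * (n + 1) * (a 0).re / (2 * (m - n)) ≤
        n * (n + 1) * C / (2 * (m - n)) := by
      gcongr
      exact (Complex.re_le_norm _).trans hC
    linarith [hpos z]
  have hform := le_toeplitzForm_re (ι := Unit) (n := n) (Q := fun k => of fun _ _ => b k)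
    (δ := (ε - n * (n + 1) * C / (2 * (m - n))) / (m + 1))
    (fun k hk => by ext; simp [hb0 k hk]) (fun z => le_re_symbol_of_le_trigSum (hbpos z)) (m + 1)
    (fun i _ => if h : i < m + 1 then v ⟨i, h⟩ else 0)
  simp only [toeplitzForm, Finset.sum_range, Fin.is_lt, dif_pos, Finset.univ_unique,
    Finset.sum_singleton, dotProduct, mulVec, of_apply, Pi.star_apply, Fin.eta] at hform
  refine hform.trans (le_of_eq ?_)
  simp only [dotProduct, mulVec, of_apply, Pi.star_apply, Finset.mul_sum, hb]
  congr 1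
  refine Finset.sum_congr rfl fun i _ => Finset.sum_congr rfl fun j _ => ?_
  push_cast
  rfl

open Matrix in
/-- The Toeplitz matrix with entries `aₖ / (m + 1 - |k|)` is a Gram matrix of `∑ aₖ zᵏ`. -/
theorem gram_cesaro_toeplitz {n m : ℕ} (hnm : n < m) {a : ℤ → ℂ}
    (ha : ∀ k, (n : ℤ) < |k| → a k = 0) (z : Circle) :
    star (fun i : Fin (m + 1) => (z : ℂ) ^ (m - (i : ℕ))) ⬝ᵥ (of (fun i j : Fin (m + 1) =>
        (((m + 1 - |((i : ℕ) : ℝ) - (j : ℕ)|)⁻¹ : ℝ) : ℂ) * a (i - j)) *ᵥ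
          fun i : Fin (m + 1) => (z : ℂ) ^ (m - (i : ℕ))) = trigSum n a z := by
  set f : ℤ → ℂ := fun k => (z : ℂ) ^ k * ((((m + 1 - |(k : ℝ)|)⁻¹ : ℝ) : ℂ) * a k) with hf
  have h1 : star (fun i : Fin (m + 1) => (z : ℂ) ^ (m - (i : ℕ))) ⬝ᵥ (of (fun i j : Fin (m + 1) =>
        (((m + 1 - |((i : ℕ) : ℝ) - (j : ℕ)|)⁻¹ : ℝ) : ℂ) * a (i - j)) *ᵥ
          fun i : Fin (m + 1) => (z : ℂ) ^ (m - (i : ℕ))) =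
      ∑ i ∈ Finset.range (m + 1), ∑ j ∈ Finset.range (m + 1), f (i - j) := by
    simp only [Finset.sum_range, dotProduct, mulVec, of_apply, Pi.star_apply, Finset.mul_sum]
    refine Finset.sum_congr rfl fun i _ => Finset.sum_congr rfl fun j _ => ?_
    -- The decreasing exponents `m - i` are chosen so that the conjugate of the `i`-th entry times
    -- the `j`-th is `z ^ (i - j)`, matching the Toeplitz index.
    have hij : (z : ℂ) ^ (i - j : ℤ) =
        star ((z : ℂ) ^ (m - (i : ℕ))) * (z : ℂ) ^ (m - (j : ℕ)) := by
      rw [← zpow_natCast, ← zpow_natCast, Circle.star_zpow, ← zpow_add₀ (Circle.coe_ne_zero z)]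
      congr 1
      omega
    rw [hf]
    simp only [hij]
    push_cast
    ring
  rw [h1, sum_range_sum_range_sub hnm.le fun k hk => by simp [hf, ha k hk], trigSum]
  refine Finset.sum_congr rfl fun k hk => ?_
  rw [Finset.mem_Icc] at hk
  have hk' : |(k : ℝ)| ≤ n := by exact_mod_cast abs_le.2 hk
  have hnm' : (n : ℝ) < m := by exact_mod_cast hnm
  have hd : (m : ℝ) + 1 - |(k : ℝ)| ≠ 0 := by linarith
  have hk'' : k.natAbs ≤ m + 1 := by omega
  have hcard : ((m + 1 - k.natAbs : ℕ) : ℂ) = ((m + 1 - |(k : ℝ)| : ℝ) : ℂ) := by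
    rw [Nat.cast_sub hk'']
    push_cast
    congr 1
    rw [← Complex.ofReal_natCast, Nat.cast_natAbs, Int.cast_abs]
  rw [nsmul_eq_mul, hcard, hf, smul_eq_mul, mul_left_comm, ← mul_assoc (_ : ℂ) _ (a k),
    ← Complex.ofReal_mul, mul_inv_cancel₀ hd, Complex.ofReal_one, one_mul]

/-! ### Degree bounds and assembly of the sum of squares. -/

theorem MvPolynomial.degreeOf_C_mul_X_pow_mul_X_pow_le (c : ℂ) (r s : ℕ) :
    (C c * (X 0 ^ r * X 1 ^ s) : MvPolynomial (Fin 2) ℂ).degreeOf 0 ≤ r ∧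
    (C c * (X 0 ^ r * X 1 ^ s) : MvPolynomial (Fin 2) ℂ).degreeOf 1 ≤ s := by
  constructor
  · refine (degreeOf_C_mul_le _ _ _).trans ((degreeOf_mul_le _ _ _).trans ?_)
    rw [degreeOf_X_self_pow, degreeOf_X_pow_of_ne _ (by decide), add_zero]
  · refine (degreeOf_C_mul_le _ _ _).trans ((degreeOf_mul_le _ _ _).trans ?_)
    rw [degreeOf_X_self_pow, degreeOf_X_pow_of_ne _ (by decide), zero_add]

open Matrix in
theorem theorem2p1 (P : ℂ[T;T⁻¹][T;T⁻¹]) (n₁ n₂ : ℕ) (hP : HasCoordDegreeLE P n₁ n₂)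
    (ε : ℝ) (hε : 0 < ε)
    (hpos : ∀ z₁ z₂ : Circle, (torusEval₂ P z₁ z₂).im = 0 ∧ ε ≤ (torusEval₂ P z₁ z₂).re)
    (m₁ : ℕ) (hm : n₁ < m₁)
    (hbound : (n₁ : ℝ) * (n₁ + 1) * coeffSup P / (2 * ((m₁ : ℝ) - n₁)) < ε) :
    ∃ N : ℕ, N ≤ m₁ + 1 ∧ ∃ Q : Fin N → MvPolynomial (Fin 2) ℂ,
      (∀ k, (Q k).degreeOf 0 ≤ m₁ ∧ (Q k).degreeOf 1 ≤ n₂) ∧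
      ∀ z₁ z₂ : Circle, torusEval₂ P z₁ z₂ =
        ((∑ k, ‖MvPolynomial.eval ![(z₁ : ℂ), (z₂ : ℂ)] (Q k)‖ ^ 2 : ℝ) : ℂ) := by
  obtain ⟨hP₁, hP₂⟩ := hP
  set a : Circle → ℤ → ℂ := fun z₂ k => torusEval₁ (P.coeff k) z₂ with ha
  have ha_eq : ∀ z₂ k, a z₂ k = trigSum n₂ (P.coeff k).coeff z₂ := fun z₂ k =>
    torusEval₁_eq_trigSum (hP₂ k) z₂
  have hPa : ∀ z₁ z₂, torusEval₂ P z₁ z₂ = trigSum n₁ (a z₂) z₁ := torusEval₂_eq_trigSum hP₁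
  have ha0 : ∀ z₂ k, (n₁ : ℤ) < |k| → a z₂ k = 0 := fun z₂ k hk => by
    simp [ha, hP₁ k hk, torusEval₁]
  have has : ∀ z₂ k, a z₂ (-k) = star (a z₂ k) := fun z₂ =>
    coeff_neg_eq_star_of_im_eq_zero (ha0 z₂) fun z₁ => hPa z₁ z₂ ▸ (hpos z₁ z₂).1
  -- Reality of `P` in `z₁` gives `p₋ₖ = p̄ₖ` at every `z₂`; comparing coefficients in `z₂` gives
  -- the joint symmetry, which makes `G` a self-adjoint symbol.
  have hPs : ∀ k l, (P.coeff (-k)).coeff (-l) = star ((P.coeff k).coeff l) := by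
    intro k l
    have h : ⇑(P.coeff (-k)).coeff = fun l => star ((P.coeff k).coeff (-l)) := by
      refine coeff_eq_of_trigSum_eq (hP₂ (-k)) (fun l hl => ?_) fun z => ?_
      · rw [hP₂ k _ (by rwa [abs_neg]), star_zero]
      · rw [← star_trigSum, ← ha_eq, ← ha_eq, has]
    simp only [h, neg_neg]
  let G : ℤ → Matrix (Fin (m₁ + 1)) (Fin (m₁ + 1)) ℂ := fun l => of fun i j =>
    (((m₁ + 1 - |((i : ℕ) : ℝ) - (j : ℕ)|)⁻¹ : ℝ) : ℂ) * (P.coeff (i - j)).coeff l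
  have hG : ∀ z₂, trigSum n₂ G z₂ = of (fun i j : Fin (m₁ + 1) =>
      (((m₁ + 1 - |((i : ℕ) : ℝ) - (j : ℕ)|)⁻¹ : ℝ) : ℂ) * a z₂ (i - j)) := by
    intro z₂
    ext i j
    simp only [trigSum, G, Matrix.sum_apply, Matrix.smul_apply, of_apply, ha_eq, Finset.mul_sum,
      smul_eq_mul]
    exact Finset.sum_congr rfl fun l _ => mul_left_comm _ _ _
  have hGs : ∀ l, G (-l) = (G l)ᴴ := by
    intro l
    ext i j
    simp only [G, conjTranspose_apply, of_apply, star_mul', Complex.star_def, Complex.conj_ofReal]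
    rw [← Complex.star_def, ← hPs, neg_sub, abs_sub_comm]
  have hm' : (0 : ℝ) < m₁ + 1 := by positivity
  -- The lower bound on the matrices depends on `z₂` only through `|p₀(z₂)|`, so replacing this by
  -- `coeffSup P` makes it uniform on the circle.
  obtain ⟨A, hA⟩ := exists_fejerRiesz_factorization (Q := G) (n := n₂)
    (fun l hl => by ext i j; simp [G, hP₂ _ l hl]) hGs (div_pos (sub_pos.2 hbound) hm')
    fun z₂ v => by
      rw [hG]
      exact le_re_cesaro_toeplitz hm (ha0 z₂) (has z₂) hε (fun z₁ => hPa z₁ z₂ ▸ (hpos z₁ z₂).2)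
        ((isLUB_coeffSup P).1 ⟨(0, z₂), rfl⟩) v
  -- The `c`-th polynomial is the `c`-th entry of `A(z₂) v(z₁)`, with `A(z₂) = ∑ z₂ʲ Aⱼ` and `v(z₁)`
  -- the vector of entries `z₁ ^ (m₁ - b)`.
  refine ⟨m₁ + 1, le_rfl, fun c => ∑ b : Fin (m₁ + 1), ∑ j ∈ Finset.range (n₂ + 1),
    MvPolynomial.C (A j c b) * (MvPolynomial.X 0 ^ (m₁ - (b : ℕ)) * MvPolynomial.X 1 ^ j),
    fun c => ?_, fun z₁ z₂ => ?_⟩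
  · constructor
    · refine (MvPolynomial.degreeOf_sum_le _ _ _).trans (Finset.sup_le fun b _ => ?_)
      refine (MvPolynomial.degreeOf_sum_le _ _ _).trans (Finset.sup_le fun j _ => ?_)
      exact (MvPolynomial.degreeOf_C_mul_X_pow_mul_X_pow_le _ _ _).1.trans (Nat.sub_le _ _)
    · refine (MvPolynomial.degreeOf_sum_le _ _ _).trans (Finset.sup_le fun b _ => ?_)
      refine (MvPolynomial.degreeOf_sum_le _ _ _).trans (Finset.sup_le fun j hj => ?_)
      exact (MvPolynomial.degreeOf_C_mul_X_pow_mul_X_pow_le _ _ _).2.trans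
        (Nat.le_of_lt_succ (Finset.mem_range.1 hj))
  · set v : Fin (m₁ + 1) → ℂ := fun i => (z₁ : ℂ) ^ (m₁ - (i : ℕ)) with hv
    set B : Matrix (Fin (m₁ + 1)) (Fin (m₁ + 1)) ℂ :=
      ∑ j ∈ Finset.range (n₂ + 1), (z₂ : ℂ) ^ j • A j with hB
    have heval : ∀ c, MvPolynomial.eval ![(z₁ : ℂ), (z₂ : ℂ)]
        (∑ b : Fin (m₁ + 1), ∑ j ∈ Finset.range (n₂ + 1),
          MvPolynomial.C (A j c b) * (MvPolynomial.X 0 ^ (m₁ - (b : ℕ)) * MvPolynomial.X 1 ^ j)) =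
        (B *ᵥ v) c := by
      intro c
      simp only [map_sum, map_mul, map_pow, MvPolynomial.eval_C, MvPolynomial.eval_X, mulVec,
        dotProduct, hB, hv, Matrix.sum_apply, Matrix.smul_apply, Finset.sum_mul, smul_eq_mul,
        Matrix.cons_val_zero, Matrix.cons_val_one]
      exact Finset.sum_congr rfl fun b _ => Finset.sum_congr rfl fun j _ => by ring
    have hgram := gram_cesaro_toeplitz hm (ha0 z₂) z₁
    rw [← hG, ← conjTranspose_mul_self_eq_trigSum hA z₂, ← mulVec_mulVec, dotProduct_mulVec,
      vecMul_conjTranspose, star_star, ← hPa] at hgram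
    simp only [heval]
    rw [← hgram, ← star_dotProduct_self_re]
    refine Complex.ext (Complex.ofReal_re _).symm ?_
    rw [Complex.ofReal_im, hgram]
    exact (hpos z₁ z₂).1
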